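/- Let $K$ be a field, let $A=K[x_1,\dots,x_n]$, $B=K[y_1,\dots,y_m]$ and $S=A\otimes_K B=K[x_1,\dots,x_n,y_1,\dots,y_m]$. For a proper graded ideal $L$ of a polynomial ring $R=\bigoplus_{d\ge 0}R_d$ over $K$ and $P\in\mathrm{Ass}(L)$, put $$\mathrm{v}_P(L)=\min\{d\ge 0 \mid L:f=P \text{ for some } f\in R_d\},\qquad \mathrm{v}(L)=\min\{\mathrm{v}_P(L)\mid P\in\mathrm{Ass}(L)\}.$$ For an ideal $L\subseteq R$ and $k\ge 0$, the symbolic power $L^{(k)}$ is defined either by $L^{(k)}=\bigcap_{P\in\mathrm{Ass}(L)}(L^kR_P\cap R)$ or by $L^{(k)}=\bigcap_{P\in\mathrm{Min}(L)}(L^kR_P\cap R)$; the following holds for each of the two definitions (the same one being used throughout). For ideals $I\subseteq A$, $J\subseteq B$ write $I+J:=IS+JS$. Let $I\subseteq A$ and $J\subseteq B$ be nonzero monomial ideals, and let $k\ge 0$. (1) If $\mathfrak p\subset A$ and $\mathfrak q\subset B$ are monomial prime ideals with $\mathfrak p+\mathfrak q\in\mathrm{Ass}((I+J)^{(k)})$,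 then $$\mathrm{v}_{\mathfrak p+\mathfrak q}((I+J)^{(k)})=\min_{\substack{0\le d<k\\ \mathfrak p\in\mathrm{Ass}(I^{(k-d)})\\ \mathfrak q\in\mathrm{Ass}(J^{(d+1)})}}\bigl(\mathrm{v}_{\mathfrak p}(I^{(k-d)})+\mathrm{v}_{\mathfrak q}(J^{(d+1)})\bigr),$$ where the minimum is over the integers $d$ satisfying the three conditions, and at least one such $d$ exists. (2) If $(I+J)^{(k)}\ne S$, then $$\mathrm{v}((I+J)^{(k)})=\min_{\substack{0\le d<k\\ \mathfrak p\in\mathrm{Ass}(I^{(k-d)})\\ \mathfrak q\in\mathrm{Ass}(J^{(d+1)})\\ \mathfrak p+\mathfrak q\in\mathrm{Ass}((I+J)^{(k)})}}\bigl(\mathrm{v}_{\mathfrak p}(I^{(k-d)})+\mathrm{v}_{\mathfrak q}(J^{(d+1)})\bigr),$$ where the minimum is over all triples $(d,\mathfrak p,\mathfrak q)$ satisfying the conditions, and at least one such triple exists. -/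

import Mathlib

/-- The set `Ass(L)` of associated primes of an ideal `L`, i.e. of the module `R ⧸ L`. -/
def idealAss {R : Type*} [CommRing R] (L : Ideal R) : Set (Ideal R) :=
  associatedPrimes R (R ⧸ L)

/-- The two usual conventions for symbolic powers: localize at all the associated primes,
or only at the minimal primes. -/
inductive SymbolicPowerKind : Type
  | associated : SymbolicPowerKind
  | minimal : SymbolicPowerKind

/-- The primes at which one localizes: `Ass(L)` or `Min(L)`. -/
def SymbolicPowerKind.primes {R : Type*} [CommRing R] (t : SymbolicPowerKind) (L : Ideal R) :
    Set (Ideal R) :=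
  match t with
  | .associated => idealAss L
  | .minimal => L.minimalPrimes

/-- The contraction `L R_P ∩ R` of the extension of `L` to the localization at the prime `P`. -/
noncomputable def localContraction {R : Type*} [CommRing R] (L P : Ideal R) [P.IsPrime] :
    Ideal R :=
  (L.map (algebraMap R (Localization.AtPrime P))).comap (algebraMap R (Localization.AtPrime P))

/-- The symbolic power `L^(k) = ⋂ (L^k R_P ∩ R)`, where `P` runs over `Ass(L)` or over `Min(L)`,
according to the convention `t`. (All members of these two sets are prime ideals.) -/
noncomputable def symbolicPower {R : Type*} [CommRing R] (t : SymbolicPowerKind) (L : Ideal R)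
    (k : ℕ) : Ideal R :=
  ⨅ (P : Ideal R) (_ : P.IsPrime) (_ : P ∈ t.primes L), localContraction (L ^ k) P

/-- A monomial ideal: an ideal generated by a set of monomials. -/
def IsMonomialIdeal {σ K : Type*} [Field K] (L : Ideal (MvPolynomial σ K)) : Prop :=
  ∃ s : Set (σ →₀ ℕ), L = Ideal.span ((fun c => MvPolynomial.monomial c (1 : K)) '' s)

/-- The local `v`-number `v_P(L)`: the least degree of a form `f` with `L : f = P`.
It is meant for a graded ideal `L` and `P ∈ Ass(L)`; then such an `f` exists. -/
noncomputable def localVNumber {σ K : Type*} [Field K] (L P : Ideal (MvPolynomial σ K)) : ℕ :=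
  sInf {d : ℕ | ∃ f : MvPolynomial σ K, f.IsHomogeneous d ∧ Submodule.colon L {f} = P}

/-- The `v`-number `v(L)`: the least degree of a form `f` with `L : f ∈ Ass(L)`.
It is meant for a proper graded ideal `L`; then such an `f` exists. -/
noncomputable def vNumber {σ K : Type*} [Field K] (L : Ideal (MvPolynomial σ K)) : ℕ :=
  sInf {d : ℕ | ∃ f : MvPolynomial σ K, ∃ P ∈ idealAss L,
    f.IsHomogeneous d ∧ Submodule.colon L {f} = P}

/-- The sum `I + J = I S + J S` of an ideal `I` of `A = K[x_1, …, x_n]` and an ideal `J` of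
`B = K[y_1, …, y_m]`, in the polynomial ring `S = K[x_1, …, x_n, y_1, …, y_m]`, where
`x_i` is the variable `Sum.inl i` and `y_j` is the variable `Sum.inr j`. -/
noncomputable def disjointSum {σ τ K : Type*} [Field K] (I : Ideal (MvPolynomial σ K))
    (J : Ideal (MvPolynomial τ K)) : Ideal (MvPolynomial (σ ⊕ τ) K) :=
  I.map (MvPolynomial.rename Sum.inl : MvPolynomial σ K →ₐ[K] MvPolynomial (σ ⊕ τ) K) ⊔
    J.map (MvPolynomial.rename Sum.inr : MvPolynomial τ K →ₐ[K] MvPolynomial (σ ⊕ τ) K)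

/-! Everything is decided by exponents. A prime of the form `L : f`, with `L` a monomial ideal, is
already `L : x^a` for some monomial `x^a` of `f` (`IsMonomialIdeal.exists_isColonExponent`), so
`v_P(L)` is the least degree of an exponent `a` with `L : x^a = P`.

The monomial form of the binomial expansion says that `x^a y^b` lies in `(I+J)^(k)` iff `x^a ∈
I^(i)` and `y^b ∈ J^(j)` for some `i + j = k`. It holds for both conventions because in both the
primes attached to `I + J` are exactly the sums `p + q` of primes attached to `I` and to `J`.

If `(I+J)^(k) : x^a y^b = p + q`, let `d` be the largest `J`-index that `y^b` reaches after
multiplication by a monomial outside `q`. Then `I^(k-d) : x^a = p` and `J^(d+1) : y^b = q`.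
Conversely such `a` and `b` combine, provided also `x^a ∈ I^(k-d-1)` and `y^b ∈ J^(d)`. This is
automatic: `p` and `q` contain variables since `I` and `J` are nonzero, and deleting one variable
costs at most one symbolic power. Degrees add, so minimal degrees correspond. -/

/-! ### Monomial ideals and their exponent sets. -/

section MonomialIdeals

open MvPolynomial

variable {σ K : Type*} [Field K]

/-- The exponents of the monomials that lie in `L`. -/
def expSet (L : Ideal (MvPolynomial σ K)) : Set (σ →₀ ℕ) :=
  {a | monomial a (1 : K) ∈ L}

theorem mem_expSet {L : Ideal (MvPolynomial σ K)} {a : σ →₀ ℕ} :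
    a ∈ expSet L ↔ monomial a (1 : K) ∈ L := Iff.rfl

theorem add_mem_expSet_left {L : Ideal (MvPolynomial σ K)} {a : σ →₀ ℕ} (b : σ →₀ ℕ)
    (h : a ∈ expSet L) : b + a ∈ expSet L := by
  have := L.mul_mem_left (monomial b (1 : K)) h
  rwa [monomial_mul, one_mul] at this

theorem add_mem_expSet_right {L : Ideal (MvPolynomial σ K)} {a : σ →₀ ℕ} (b : σ →₀ ℕ)
    (h : a ∈ expSet L) : a + b ∈ expSet L :=
  add_comm b a ▸ add_mem_expSet_left b h

theorem expSet_mono {L M : Ideal (MvPolynomial σ K)} (h : L ≤ M) : expSet L ⊆ expSet M :=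
  fun _ ha => h ha

theorem zero_mem_expSet_iff {L : Ideal (MvPolynomial σ K)} : 0 ∈ expSet L ↔ L = ⊤ :=
  (Ideal.eq_top_iff_one L).symm

theorem Ideal.IsPrime.zero_notMem_expSet {P : Ideal (MvPolynomial σ K)} (hP : P.IsPrime) :
    0 ∉ expSet P :=
  fun h => hP.ne_top (zero_mem_expSet_iff.1 h)

theorem Ideal.IsPrime.add_mem_expSet_iff {P : Ideal (MvPolynomial σ K)} (hP : P.IsPrime)
    {a b : σ →₀ ℕ} : a + b ∈ expSet P ↔ a ∈ expSet P ∨ b ∈ expSet P := by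
  simp only [mem_expSet]
  rw [← hP.mul_mem_iff_mem_or_mem, monomial_mul, one_mul]

theorem mem_of_support_subset {L : Ideal (MvPolynomial σ K)} {f : MvPolynomial σ K}
    (h : ∀ a ∈ f.support, a ∈ expSet L) : f ∈ L := by
  rw [f.as_sum]
  refine L.sum_mem fun a ha => ?_
  have := L.mul_mem_left (C (coeff a f)) (h a ha)
  rwa [C_mul_monomial, mul_one] at this

theorem IsMonomialIdeal.mem_expSet_of_mem {L : Ideal (MvPolynomial σ K)} (hL : IsMonomialIdeal L)
    {f : MvPolynomial σ K} (hf : f ∈ L) {a : σ →₀ ℕ} (ha : a ∈ f.support) : a ∈ expSet L := by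
  obtain ⟨s, rfl⟩ := hL
  obtain ⟨b, hb, hba⟩ := mem_ideal_span_monomial_image.1 hf a ha
  obtain ⟨c, rfl⟩ := exists_add_of_le hba
  exact add_mem_expSet_right c (Ideal.subset_span ⟨b, hb, rfl⟩)

theorem isMonomialIdeal_of_forall_mem {L : Ideal (MvPolynomial σ K)}
    (h : ∀ f ∈ L, ∀ a ∈ f.support, a ∈ expSet L) : IsMonomialIdeal L := by
  refine ⟨expSet L, le_antisymm (fun f hf => ?_) ?_⟩
  · exact mem_of_support_subset fun a ha => Ideal.subset_span ⟨a, h f hf a ha, rfl⟩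
  · rw [Ideal.span_le]
    rintro _ ⟨a, ha, rfl⟩
    exact ha

theorem IsMonomialIdeal.le_of_expSet_subset {L M : Ideal (MvPolynomial σ K)}
    (hL : IsMonomialIdeal L) (h : expSet L ⊆ expSet M) : L ≤ M :=
  fun _ hf => mem_of_support_subset fun _ ha => h (hL.mem_expSet_of_mem hf ha)

theorem IsMonomialIdeal.eq_of_expSet_eq {L M : Ideal (MvPolynomial σ K)}
    (hL : IsMonomialIdeal L) (hM : IsMonomialIdeal M) (h : expSet L = expSet M) : L = M :=
  le_antisymm (hL.le_of_expSet_subset h.subset) (hM.le_of_expSet_subset h.superset)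

theorem IsMonomialIdeal.exists_mem_expSet {L : Ideal (MvPolynomial σ K)}
    (hL : IsMonomialIdeal L) (h0 : L ≠ ⊥) : ∃ a, a ∈ expSet L := by
  by_contra! h
  exact h0 (le_bot_iff.1 (hL.le_of_expSet_subset fun a ha => (h a ha).elim))

theorem mem_expSet_span {s : Set (σ →₀ ℕ)} {a : σ →₀ ℕ} :
    a ∈ expSet (Ideal.span ((fun c => monomial c (1 : K)) '' s)) ↔ ∃ b ∈ s, b ≤ a := by
  rw [mem_expSet, mem_ideal_span_monomial_image]
  classical
  simp [support_monomial]

theorem isMonomialIdeal_iInf {ι : Sort*} {L : ι → Ideal (MvPolynomial σ K)}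
    (h : ∀ i, IsMonomialIdeal (L i)) : IsMonomialIdeal (⨅ i, L i) := by
  refine isMonomialIdeal_of_forall_mem fun f hf a ha => ?_
  rw [mem_expSet, Ideal.mem_iInf]
  exact fun i => (h i).mem_expSet_of_mem (Ideal.mem_iInf.1 hf i) ha

theorem IsMonomialIdeal.mul {L M : Ideal (MvPolynomial σ K)} (hL : IsMonomialIdeal L)
    (hM : IsMonomialIdeal M) : IsMonomialIdeal (L * M) := by
  obtain ⟨s, rfl⟩ := hL
  obtain ⟨t, rfl⟩ := hM
  refine ⟨Set.image2 (· + ·) s t, ?_⟩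
  rw [Ideal.span_mul_span']
  congr 1
  ext f
  simp only [Set.mem_mul, Set.mem_image, Set.mem_image2]
  constructor
  · rintro ⟨_, ⟨a, ha, rfl⟩, _, ⟨b, hb, rfl⟩, rfl⟩
    exact ⟨a + b, ⟨a, ha, b, hb, rfl⟩, by rw [monomial_mul, one_mul]⟩
  · rintro ⟨_, ⟨a, ha, b, hb, rfl⟩, rfl⟩
    exact ⟨_, ⟨a, ha, rfl⟩, _, ⟨b, hb, rfl⟩, by rw [monomial_mul, one_mul]⟩

theorem add_mem_expSet_mul {L M : Ideal (MvPolynomial σ K)} {a b : σ →₀ ℕ}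
    (ha : a ∈ expSet L) (hb : b ∈ expSet M) : a + b ∈ expSet (L * M) := by
  have := Ideal.mul_mem_mul ha hb
  rwa [monomial_mul, one_mul] at this

/-- Products of a monomial of `L` and one of `M` generate `L * M`; what remains after dividing by
such a generator is absorbed into the second factor. -/
theorem IsMonomialIdeal.exists_add_of_mem_expSet_mul {L M : Ideal (MvPolynomial σ K)}
    (hL : IsMonomialIdeal L) (hM : IsMonomialIdeal M) {a : σ →₀ ℕ} (ha : a ∈ expSet (L * M)) :
    ∃ b ∈ expSet L, ∃ c ∈ expSet M, b + c = a := by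
  have h : L * M = Ideal.span ((fun c => monomial c (1 : K)) ''
      Set.image2 (fun b c => b + c) (expSet L) (expSet M)) := by
    refine (hL.mul hM).eq_of_expSet_eq ⟨_, rfl⟩ (Set.Subset.antisymm ?_ ?_)
    · refine expSet_mono (Ideal.mul_le.2 fun f hf g hg => mem_of_support_subset fun c hc => ?_)
      classical
      obtain ⟨b, hb, d, hd, rfl⟩ := Finset.mem_add.1 (support_mul f g hc)
      exact mem_expSet_span.2 ⟨_, ⟨b, hL.mem_expSet_of_mem hf hb, d, hM.mem_expSet_of_mem hg hd,
        rfl⟩, le_rfl⟩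
    · refine expSet_mono ?_
      rw [Ideal.span_le]
      rintro _ ⟨_, ⟨b, hb, d, hd, rfl⟩, rfl⟩
      exact add_mem_expSet_mul hb hd
  rw [h, mem_expSet_span] at ha
  obtain ⟨_, ⟨b, hb, d, hd, rfl⟩, hle⟩ := ha
  obtain ⟨e, rfl⟩ := exists_add_of_le hle
  exact ⟨b, hb, d + e, add_mem_expSet_right e hd, (add_assoc _ _ _).symm⟩

theorem isMonomialIdeal_top : IsMonomialIdeal (⊤ : Ideal (MvPolynomial σ K)) :=
  isMonomialIdeal_of_forall_mem fun _ _ _ _ => mem_expSet.2 Submodule.mem_top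

theorem IsMonomialIdeal.pow {L : Ideal (MvPolynomial σ K)} (hL : IsMonomialIdeal L) (k : ℕ) :
    IsMonomialIdeal (L ^ k) := by
  induction k with
  | zero => simpa [Ideal.one_eq_top] using isMonomialIdeal_top
  | succ k ih => exact pow_succ L k ▸ ih.mul hL

/-- A polynomial is congruent modulo `L` to the part of it whose exponents lie outside
`expSet L`. -/
theorem exists_reduced (L : Ideal (MvPolynomial σ K)) (f : MvPolynomial σ K) :
    ∃ g, f - g ∈ L ∧ ∀ a, a ∈ g.support ↔ a ∈ f.support ∧ a ∉ expSet L := by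
  classical
  let g : MvPolynomial σ K := ∑ a ∈ f.support with a ∉ expSet L, monomial a (coeff a f)
  have hg : ∀ a, coeff a g = if a ∈ expSet L then 0 else coeff a f := by
    intro a
    simp only [g, coeff_sum, coeff_monomial, Finset.sum_ite_eq', Finset.mem_filter, mem_support_iff]
    split_ifs <;> simp_all
  refine ⟨g, mem_of_support_subset fun a ha => ?_, fun a => ?_⟩
  · by_contra h
    simp [hg, h] at ha
  · rw [mem_support_iff, hg, mem_support_iff]
    by_cases h : a ∈ expSet L <;> simp [h]

/-! ### Associated primes, colon ideals and v-numbers. -/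

theorem idealAss_iff [Finite σ] {L P : Ideal (MvPolynomial σ K)} :
    P ∈ idealAss L ↔ P.IsPrime ∧ ∃ f, Submodule.colon L {f} = P := by
  unfold idealAss
  rw [AssociatedPrimes.mem_iff, IsAssociatedPrime, Submodule.isAssociatedPrime_iff]
  refine and_congr_right fun _ => ?_
  have key : ∀ f : MvPolynomial σ K, Submodule.colon L {f} =
      Submodule.colon (⊥ : Submodule (MvPolynomial σ K) (MvPolynomial σ K ⧸ L))
        {Ideal.Quotient.mk L f} := by
    intro f
    ext r
    rw [Submodule.mem_colon_singleton, Submodule.mem_colon_singleton, Submodule.mem_bot,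
      ← Ideal.Quotient.eq_zero_iff_mem, smul_eq_mul, map_mul]
    rfl
  constructor
  · rintro ⟨x, hx⟩
    obtain ⟨f, rfl⟩ := Ideal.Quotient.mk_surjective x
    exact ⟨f, (key f).trans hx.symm⟩
  · rintro ⟨f, hf⟩
    exact ⟨_, ((key f).symm.trans hf).symm⟩

theorem exists_idealAss_of_notMem [Finite σ] {L : Ideal (MvPolynomial σ K)} {f : MvPolynomial σ K}
    (hf : f ∉ L) : ∃ P ∈ idealAss L, ∀ g, g * f ∈ L → g ∈ P := by
  obtain ⟨P, hP, hle⟩ := exists_le_isAssociatedPrime_of_isNoetherianRing (MvPolynomial σ K)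
    (Ideal.Quotient.mk L f) (fun h => hf (Ideal.Quotient.eq_zero_iff_mem.1 h))
  refine ⟨P, hP, fun g hg => hle ?_⟩
  rw [Submodule.mem_colon_singleton, Submodule.mem_bot]
  exact (Ideal.Quotient.eq_zero_iff_mem (I := L) (a := g * f)).2 hg

/-- A prime of the form `L : f`, where `L` is a monomial ideal, is a monomial ideal. -/
theorem IsMonomialIdeal.isMonomialIdeal_colon [Finite σ] {L P : Ideal (MvPolynomial σ K)}
    (hL : IsMonomialIdeal L) (hP : P.IsPrime) (f : MvPolynomial σ K)
    (hf : Submodule.colon L {f} = P) : IsMonomialIdeal P := by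
  have hmem : ∀ {g h : MvPolynomial σ K}, Submodule.colon L {g} = P → (h ∈ P ↔ h * g ∈ L) := by
    rintro g h rfl
    rw [Submodule.mem_colon_singleton, smul_eq_mul]
  induction hn : f.support.card using Nat.strong_induction_on generalizing f with
  | _ n ih =>
  -- If `x^α` outside `P` sends a term of `f` into `L`, pass to `x^α f` reduced modulo `L`: the
  -- colon is unchanged because `P` is prime, and the number of terms drops.
  by_cases H : ∃ α ∉ expSet P, ∃ β ∈ f.support, α + β ∈ expSet L
  · obtain ⟨α, hα, β, hβ, hαβ⟩ := H
    obtain ⟨g, hg, hgs⟩ := exists_reduced L (monomial α 1 * f)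
    refine ih g.support.card ?_ g ?_ rfl
    · classical
      have hsupp : (monomial α (1 : K) * f).support ⊆ f.support.image (α + ·) := by
        intro c hc
        obtain ⟨b, hb, d, hd, rfl⟩ := Finset.mem_add.1 (support_mul _ _ hc)
        rw [Finset.mem_singleton.1 (support_monomial_subset hb)]
        exact Finset.mem_image_of_mem _ hd
      have hlt : g.support ⊂ f.support.image (α + ·) := by
        refine (Finset.ssubset_iff_of_subset fun c hc => hsupp ((hgs c).1 hc).1).2
          ⟨α + β, Finset.mem_image_of_mem _ hβ, fun h => ((hgs _).1 h).2 hαβ⟩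
      exact hn ▸ (Finset.card_lt_card hlt).trans_le Finset.card_image_le
    · ext r
      have h1 : r * (monomial α 1 * f) - r * g ∈ L := by
        rw [← mul_sub]
        exact L.mul_mem_left r hg
      rw [Submodule.mem_colon_singleton, smul_eq_mul, ← L.add_mem_iff_right h1, sub_add_cancel,
        ← mul_assoc, ← hmem hf, hP.mul_mem_iff_mem_or_mem]
      exact or_iff_left hα
  · push Not at H
    -- Otherwise, an element of `P` with a term outside `P` reduces to some `g' ≠ 0` in `P` with no
    -- term in `P`. The leading monomial of `g' f ∈ L` then lies in `L`, against `H`.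
    refine isMonomialIdeal_of_forall_mem fun g hg a ha => ?_
    by_contra haP
    obtain ⟨g', hg', hgs⟩ := exists_reduced P g
    have hg'P : g' ∈ P := by simpa using P.sub_mem hg hg'
    have hg0 : g' ≠ 0 := by
      rintro rfl
      simpa using (hgs a).2 ⟨ha, haP⟩
    have hf0 : f ≠ 0 := by
      rintro rfl
      exact hP.ne_top ((Ideal.eq_top_iff_one P).2 ((hmem hf).2 (by simp)))
    classical
    let _ : LinearOrder σ := linearOrderOfSTO (WellOrderingRel : σ → σ → Prop)
    let m : MonomialOrder σ := MonomialOrder.lex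
    have hmul : m.degree g' + m.degree f ∈ (g' * f).support := by
      rw [← MonomialOrder.degree_mul hg0 hf0]
      exact m.degree_mem_support (mul_ne_zero hg0 hf0)
    exact H _ ((hgs _).1 (m.degree_mem_support hg0)).2 _ (m.degree_mem_support hf0)
      (hL.mem_expSet_of_mem ((hmem hf).1 hg'P) hmul)

/-- `L : x ^ a = P`, in terms of exponents. -/
def IsColonExponent (L P : Ideal (MvPolynomial σ K)) (a : σ →₀ ℕ) : Prop :=
  ∀ b, a + b ∈ expSet L ↔ b ∈ expSet P

theorem IsMonomialIdeal.colon_monomial_eq {L P : Ideal (MvPolynomial σ K)}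
    (hL : IsMonomialIdeal L) (hP : IsMonomialIdeal P) {a : σ →₀ ℕ} (ha : IsColonExponent L P a) :
    Submodule.colon L {monomial a (1 : K)} = P := by
  have hmem : ∀ b, b ∈ expSet (Submodule.colon L {monomial a (1 : K)}) ↔ a + b ∈ expSet L := by
    intro b
    rw [mem_expSet, Submodule.mem_colon_singleton, smul_eq_mul, monomial_mul, one_mul, add_comm,
      mem_expSet]
  refine eq_of_expSet_eq (isMonomialIdeal_of_forall_mem fun f hf b hb => ?_) hP ?_
  · rw [hmem]
    refine hL.mem_expSet_of_mem (Submodule.mem_colon_singleton.1 hf) ?_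
    rw [mem_support_iff, smul_eq_mul, add_comm a, coeff_mul_monomial, mul_one]
    exact mem_support_iff.1 hb
  · ext b
    rw [hmem, ha b]

/-- Each monomial of `P` multiplies every term of `f` into `L`. If each term were also sent into `L`
by some monomial outside `P`, the product of these monomials would send `f` into `L`, hence lie in
the prime `P`. -/
theorem IsMonomialIdeal.exists_isColonExponent [Finite σ] {L P : Ideal (MvPolynomial σ K)}
    (hL : IsMonomialIdeal L) (hP : P.IsPrime) {f : MvPolynomial σ K}
    (hf : Submodule.colon L {f} = P) : ∃ a ∈ f.support, IsColonExponent L P a := by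
  have hPm := hL.isMonomialIdeal_colon hP f hf
  have hmem : ∀ g, g ∈ P ↔ g * f ∈ L := by
    intro g
    rw [← hf, Submodule.mem_colon_singleton, smul_eq_mul]
  have h1 : ∀ a ∈ f.support, ∀ b ∈ expSet P, a + b ∈ expSet L := by
    intro a ha b hb
    refine hL.mem_expSet_of_mem ((hmem _).1 hb) ?_
    rw [mem_support_iff, add_comm a, coeff_monomial_mul, one_mul]
    exact mem_support_iff.1 ha
  by_contra! H
  have h2 : ∀ a ∈ f.support, ∃ b, a + b ∈ expSet L ∧ b ∉ expSet P := by
    intro a ha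
    by_contra! h
    exact H a ha fun b => ⟨h b, h1 a ha b⟩
  choose! c hc hcP using h2
  have h3 : ∏ a ∈ f.support, monomial (c a) (1 : K) ∈ P := by
    rw [hmem]
    nth_rewrite 2 [f.as_sum]
    rw [Finset.mul_sum]
    refine L.sum_mem fun a ha => ?_
    classical
    rw [← Finset.mul_prod_erase _ _ ha, mul_right_comm, monomial_mul, add_comm (c a), one_mul]
    refine L.mul_mem_right _ (mem_of_support_subset fun d hd => ?_)
    rw [Finset.mem_singleton.1 (support_monomial_subset hd)]
    exact hc a ha
  obtain ⟨a, ha, haP⟩ := hP.prod_mem_iff.1 h3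
  exact hcP a ha haP

theorem IsMonomialIdeal.mem_idealAss_iff [Finite σ] {L P : Ideal (MvPolynomial σ K)}
    (hL : IsMonomialIdeal L) :
    P ∈ idealAss L ↔ IsMonomialIdeal P ∧ P.IsPrime ∧ ∃ a, IsColonExponent L P a := by
  rw [idealAss_iff]
  constructor
  · rintro ⟨hP, f, hf⟩
    obtain ⟨a, -, ha⟩ := hL.exists_isColonExponent hP hf
    exact ⟨hL.isMonomialIdeal_colon hP f hf, hP, a, ha⟩
  · rintro ⟨hPm, hP, a, ha⟩
    exact ⟨hP, _, hL.colon_monomial_eq hPm ha⟩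

/-- The local `v`-number of a monomial ideal is attained at a monomial. -/
theorem IsMonomialIdeal.localVNumber_isLeast [Finite σ] {L P : Ideal (MvPolynomial σ K)}
    (hL : IsMonomialIdeal L) (hP : P ∈ idealAss L) :
    IsLeast {d | ∃ a, IsColonExponent L P a ∧ a.degree = d} (localVNumber L P) := by
  obtain ⟨hPm, hPp, a₀, ha₀⟩ := hL.mem_idealAss_iff.1 hP
  have heq : {d : ℕ | ∃ f : MvPolynomial σ K, f.IsHomogeneous d ∧ Submodule.colon L {f} = P} =
      {d | ∃ a, IsColonExponent L P a ∧ a.degree = d} := by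
    ext d
    constructor
    · rintro ⟨f, hfd, hf⟩
      obtain ⟨a, ha, haP⟩ := hL.exists_isColonExponent hPp hf
      refine ⟨a, haP, ?_⟩
      by_contra h
      exact mem_support_iff.1 ha (hfd.coeff_eq_zero h)
    · rintro ⟨a, ha, rfl⟩
      exact ⟨_, isHomogeneous_monomial 1 rfl, hL.colon_monomial_eq hPm ha⟩
  rw [localVNumber, heq]
  exact ⟨Nat.sInf_mem ⟨_, a₀, ha₀, rfl⟩, fun d hd => Nat.sInf_le hd⟩

/-- Since `sInf ∅ = 0` in `ℕ`, an associated prime is needed first; properness of `L` and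
Noetherianity supply it. -/
theorem IsMonomialIdeal.vNumber_isLeast [Finite σ] {L : Ideal (MvPolynomial σ K)}
    (hL : IsMonomialIdeal L) (hL1 : L ≠ ⊤) :
    IsLeast {d | ∃ P ∈ idealAss L, localVNumber L P = d} (vNumber L) := by
  obtain ⟨P₀, hP₀, -⟩ := exists_idealAss_of_notMem (fun h => hL1 ((Ideal.eq_top_iff_one L).2 h))
  have hloc : ∀ P ∈ idealAss L, ∃ f : MvPolynomial σ K, f.IsHomogeneous (localVNumber L P) ∧
      Submodule.colon L {f} = P := by
    intro P hP
    obtain ⟨a, ha, had⟩ := (hL.localVNumber_isLeast hP).1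
    exact ⟨_, isHomogeneous_monomial 1 had, hL.colon_monomial_eq (hL.mem_idealAss_iff.1 hP).1 ha⟩
  have hle : ∀ P ∈ idealAss L, vNumber L ≤ localVNumber L P := by
    intro P hP
    obtain ⟨f, hfd, hf⟩ := hloc P hP
    exact Nat.sInf_le ⟨f, P, hP, hfd, hf⟩
  refine ⟨?_, ?_⟩
  · obtain ⟨f₀, h₀, h₀'⟩ := hloc P₀ hP₀
    obtain ⟨f, P, hP, hfd, hf⟩ : vNumber L ∈ {d : ℕ | ∃ f : MvPolynomial σ K, ∃ P ∈ idealAss L,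
        f.IsHomogeneous d ∧ Submodule.colon L {f} = P} :=
      Nat.sInf_mem ⟨_, f₀, P₀, hP₀, h₀, h₀'⟩
    exact ⟨P, hP, le_antisymm (Nat.sInf_le ⟨f, hfd, hf⟩) (hle P hP)⟩
  · rintro _ ⟨P, hP, rfl⟩
    exact hle P hP

/-- A monomial ideal is prime as soon as it is prime with respect to monomials. -/
theorem IsMonomialIdeal.isPrime_of_expSet [Finite σ] {L : Ideal (MvPolynomial σ K)}
    (hL : IsMonomialIdeal L) (h0 : 0 ∉ expSet L)
    (h : ∀ a b, a + b ∈ expSet L → a ∈ expSet L ∨ b ∈ expSet L) : L.IsPrime := by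
  -- `L` equals any of its associated primes `P = L : x^a`: as `x^a ∉ L`, the hypothesis on
  -- monomials makes `L : x^a` and `L` contain the same monomials.
  obtain ⟨P, hP, -⟩ := exists_idealAss_of_notMem (f := 1) h0
  obtain ⟨hPm, hPp, a, ha⟩ := hL.mem_idealAss_iff.1 hP
  have haL : a ∉ expSet L := fun h' => hPp.zero_notMem_expSet ((ha 0).1 (by rwa [add_zero]))
  have : L = P := hL.eq_of_expSet_eq hPm <| by
    ext b
    rw [← ha b]
    exact ⟨add_mem_expSet_left a, fun hb => (h a b hb).resolve_left haL⟩
  rwa [this]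

/-! ### Localization and symbolic powers of monomial ideals. -/

theorem mem_localContraction {M P : Ideal (MvPolynomial σ K)} [P.IsPrime] {f : MvPolynomial σ K} :
    f ∈ localContraction M P ↔ ∃ g ∉ P, g * f ∈ M := by
  rw [localContraction, Ideal.mem_comap,
    IsLocalization.algebraMap_mem_map_algebraMap_iff P.primeCompl]
  rfl

/-- Monomial denominators suffice. Let `L` be the right-hand side. If `y f ∈ M ⊆ L` and `f ∉ L`,
then `y` lies in an associated prime `Q = L : x^a`. Monomials outside `P` cannot multiply `x^a ∉ L`
into `L`, so the monomial ideal `Q` is inside `P`, and `y ∈ P`. -/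
theorem IsMonomialIdeal.localContraction_eq [Finite σ] {M P : Ideal (MvPolynomial σ K)}
    [hPp : P.IsPrime] (hM : IsMonomialIdeal M) :
    localContraction M P = Ideal.span ((fun c => monomial c (1 : K)) ''
      {a | ∃ c ∉ expSet P, c + a ∈ expSet M}) := by
  set L := Ideal.span ((fun c => monomial c (1 : K)) '' {a | ∃ c ∉ expSet P, c + a ∈ expSet M})
    with hLdef
  have hL : IsMonomialIdeal L := ⟨_, rfl⟩
  have hLs : ∀ a ∈ expSet L, ∃ c ∉ expSet P, c + a ∈ expSet M := by
    intro a ha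
    rw [hLdef, mem_expSet_span] at ha
    obtain ⟨b, ⟨c, hc, hcb⟩, hba⟩ := ha
    obtain ⟨d, rfl⟩ := exists_add_of_le hba
    exact ⟨c, hc, add_assoc c b d ▸ add_mem_expSet_right d hcb⟩
  have hsL : ∀ a c, c ∉ expSet P → c + a ∈ expSet M → a ∈ expSet L :=
    fun a c hc h => Ideal.subset_span ⟨a, ⟨c, hc, h⟩, rfl⟩
  refine le_antisymm (fun f hf => ?_) ?_
  · by_contra hfL
    obtain ⟨y, hy, hyf⟩ := mem_localContraction.1 hf
    obtain ⟨Q, hQ, hfQ⟩ := exists_idealAss_of_notMem hfL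
    obtain ⟨hQm, hQp, a, ha⟩ := hL.mem_idealAss_iff.1 hQ
    have hML : M ≤ L := hM.le_of_expSet_subset fun b hb =>
      hsL b 0 hPp.zero_notMem_expSet (by rwa [zero_add])
    refine hy (hQm.le_of_expSet_subset (fun b hb => ?_) (hfQ y (hML hyf)))
    by_contra hbP
    obtain ⟨c, hc, hcab⟩ := hLs _ ((ha b).2 hb)
    have haL : a ∈ expSet L := by
      refine hsL a (c + b) (fun h => (hPp.add_mem_expSet_iff.1 h).elim hc hbP) ?_
      rwa [add_assoc, add_comm b]
    exact hQp.zero_notMem_expSet ((ha 0).1 (by rwa [add_zero]))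
  · rw [hLdef, Ideal.span_le]
    rintro _ ⟨a, ⟨c, hc, h⟩, rfl⟩
    refine mem_localContraction.2 ⟨monomial c 1, hc, ?_⟩
    rwa [monomial_mul, one_mul]

theorem mem_expSet_localContraction [Finite σ] {M P : Ideal (MvPolynomial σ K)}
    [P.IsPrime] (hM : IsMonomialIdeal M) {a : σ →₀ ℕ} :
    a ∈ expSet (localContraction M P) ↔ ∃ c ∉ expSet P, c + a ∈ expSet M := by
  rw [hM.localContraction_eq, mem_expSet_span]
  constructor
  · rintro ⟨b, ⟨c, hc, hcb⟩, hba⟩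
    obtain ⟨d, rfl⟩ := exists_add_of_le hba
    exact ⟨c, hc, add_assoc c b d ▸ add_mem_expSet_right d hcb⟩
  · exact fun h => ⟨a, h, le_rfl⟩

theorem mem_idealAss_of_mem_primes [Finite σ] {L P : Ideal (MvPolynomial σ K)}
    {t : SymbolicPowerKind} (hP : P ∈ t.primes L) : P ∈ idealAss L := by
  cases t with
  | associated => exact hP
  | minimal =>
    have := Module.associatedPrimes.minimalPrimes_annihilator_subset_associatedPrimes
      (MvPolynomial σ K) (MvPolynomial σ K ⧸ L)
    rw [Ideal.annihilator_quotient] at this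
    exact this hP

theorem IsMonomialIdeal.of_mem_primes [Finite σ] {L P : Ideal (MvPolynomial σ K)}
    (hL : IsMonomialIdeal L) {t : SymbolicPowerKind} (hP : P ∈ t.primes L) :
    IsMonomialIdeal P ∧ P.IsPrime :=
  have := hL.mem_idealAss_iff.1 (mem_idealAss_of_mem_primes hP)
  ⟨this.1, this.2.1⟩

theorem IsMonomialIdeal.symbolicPower [Finite σ] {L : Ideal (MvPolynomial σ K)}
    (hL : IsMonomialIdeal L) (t : SymbolicPowerKind) (k : ℕ) :
    IsMonomialIdeal (symbolicPower t L k) := by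
  refine isMonomialIdeal_iInf fun P => isMonomialIdeal_iInf fun hPp =>
    isMonomialIdeal_iInf fun _ => ?_
  rw [(hL.pow k).localContraction_eq]
  exact ⟨_, rfl⟩

theorem IsMonomialIdeal.mem_expSet_symbolicPower [Finite σ] {L : Ideal (MvPolynomial σ K)}
    (hL : IsMonomialIdeal L) {t : SymbolicPowerKind} {k : ℕ} {a : σ →₀ ℕ} :
    a ∈ expSet (_root_.symbolicPower t L k) ↔
      ∀ P ∈ t.primes L, ∃ c ∉ expSet P, c + a ∈ expSet (L ^ k) := by
  rw [mem_expSet]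
  simp only [_root_.symbolicPower, Submodule.mem_iInf]
  constructor
  · intro h P hP
    have hPp := (hL.of_mem_primes hP).2
    exact (mem_expSet_localContraction (hL.pow k)).1 (h P hPp hP)
  · intro h P hPp hP
    exact (mem_expSet_localContraction (hL.pow k)).2 (h P hP)

end MonomialIdeals

/-! ### Dropping one symbolic power by deleting a variable. -/

section SymbolicPowers

open MvPolynomial

variable {σ K : Type*} [Field K]

/-- Of `s + 1` monomial factors from `L`, deleting one variable spoils at most one. -/
theorem IsMonomialIdeal.mem_expSet_pow_of_single_add {L : Ideal (MvPolynomial σ K)}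
    (hL : IsMonomialIdeal L) (i : σ) {s : ℕ} {a : σ →₀ ℕ}
    (h : Finsupp.single i 1 + a ∈ expSet (L ^ (s + 1))) : a ∈ expSet (L ^ s) := by
  induction s generalizing a with
  | zero => simp [mem_expSet]
  | succ s ih =>
    rw [pow_succ] at h
    obtain ⟨b, hb, l, hl, hbl⟩ := (hL.pow (s + 1)).exists_add_of_mem_expSet_mul hL h
    have hi : 0 < b i ∨ 0 < l i := by
      have := DFunLike.congr_fun hbl i
      simp only [Finsupp.add_apply, Finsupp.single_eq_same] at this
      omega
    rcases hi with hi | hi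
    · obtain ⟨b', rfl⟩ := exists_add_of_le (Finsupp.single_le_iff.2 (Nat.succ_le_of_lt hi))
      rw [add_assoc] at hbl
      rw [← add_left_cancel hbl, pow_succ]
      exact add_mem_expSet_mul (ih hb) hl
    · obtain ⟨l', rfl⟩ := exists_add_of_le (Finsupp.single_le_iff.2 (Nat.succ_le_of_lt hi))
      rw [add_left_comm] at hbl
      rw [← add_left_cancel hbl]
      exact add_mem_expSet_right _ hb

theorem Ideal.IsPrime.exists_single_mem_expSet {P : Ideal (MvPolynomial σ K)} (hP : P.IsPrime)
    {a : σ →₀ ℕ} (ha : a ∈ expSet P) : ∃ i, Finsupp.single i 1 ∈ expSet P := by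
  induction a using Finsupp.induction_linear with
  | zero => exact (hP.zero_notMem_expSet ha).elim
  | add f g hf hg => exact (hP.add_mem_expSet_iff.1 ha).elim hf hg
  | single i n =>
    induction n with
    | zero => exact (hP.zero_notMem_expSet (by simpa using ha)).elim
    | succ n ih =>
      rw [Finsupp.single_add] at ha
      exact (hP.add_mem_expSet_iff.1 ha).elim ih fun h => ⟨i, h⟩

variable {L : Ideal (MvPolynomial σ K)} {t : SymbolicPowerKind}

theorem symbolicPower_zero : symbolicPower t L 0 = ⊤ := by
  simp [symbolicPower, localContraction, Ideal.one_eq_top, Ideal.map_top]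

theorem symbolicPower_antitone : Antitone (symbolicPower t L) := fun _ _ h =>
  iInf_mono fun _ => iInf_mono fun _ => iInf_mono fun _ =>
    Ideal.comap_mono (Ideal.map_mono (Ideal.pow_le_pow_right h))

variable [Finite σ]

theorem IsMonomialIdeal.mem_expSet_symbolicPower_of_pow (hL : IsMonomialIdeal L) {k : ℕ}
    {a : σ →₀ ℕ} (h : a ∈ expSet (L ^ k)) : a ∈ expSet (_root_.symbolicPower t L k) :=
  hL.mem_expSet_symbolicPower.2 fun _ hP =>
    ⟨0, (hL.of_mem_primes hP).2.zero_notMem_expSet, by rwa [zero_add]⟩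

/-- As `L ≠ 0`, the colon `P` contains a monomial, hence a variable `x_i`. So `x_i x^a` lies in the
symbolic power `s + 1`, and `x_i` can be deleted at each prime separately. -/
theorem IsMonomialIdeal.mem_expSet_symbolicPower_of_isColonExponent (hL : IsMonomialIdeal L)
    (hL0 : L ≠ ⊥) {P : Ideal (MvPolynomial σ K)} (hP : P.IsPrime) {s : ℕ} {a : σ →₀ ℕ}
    (ha : IsColonExponent (_root_.symbolicPower t L (s + 1)) P a) :
    a ∈ expSet (_root_.symbolicPower t L s) := by
  obtain ⟨b, hb⟩ := (hL.pow (s + 1)).exists_mem_expSet (pow_ne_zero _ hL0)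
  obtain ⟨i, hi⟩ := hP.exists_single_mem_expSet
    ((ha b).1 (add_mem_expSet_left a (hL.mem_expSet_symbolicPower_of_pow hb)))
  rw [hL.mem_expSet_symbolicPower]
  intro Q hQ
  obtain ⟨c, hc, hca⟩ := hL.mem_expSet_symbolicPower.1 ((ha _).2 hi) Q hQ
  refine ⟨c, hc, hL.mem_expSet_pow_of_single_add i ?_⟩
  rwa [← add_assoc, add_comm (c + a)] at hca

end SymbolicPowers

/-! ### Sums in disjoint variables and the binomial expansion. -/

section Sums

open MvPolynomial

variable {σ τ K : Type*} [Field K]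

theorem exists_sumElim_eq (c : σ ⊕ τ →₀ ℕ) : ∃ a b, Finsupp.sumElim a b = c :=
  ⟨_, _, Finsupp.comapDomain_sumElim_comapDomain c⟩

theorem rename_inl_monomial (a : σ →₀ ℕ) :
    rename (Sum.inl : σ → σ ⊕ τ) (monomial a (1 : K)) = monomial (a.sumElim 0) 1 := by
  rw [rename_monomial, Finsupp.sumElim_eq_add, Finsupp.mapDomain_zero, add_zero]

theorem rename_inr_monomial (b : τ →₀ ℕ) :
    rename (Sum.inr : τ → σ ⊕ τ) (monomial b (1 : K)) =
      monomial (Finsupp.sumElim (0 : σ →₀ ℕ) b) 1 := by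
  rw [rename_monomial, Finsupp.sumElim_eq_add, Finsupp.mapDomain_zero, zero_add]

theorem disjointSum_span (s : Set (σ →₀ ℕ)) (t : Set (τ →₀ ℕ)) :
    disjointSum (Ideal.span ((fun c => monomial c (1 : K)) '' s))
        (Ideal.span ((fun c => monomial c (1 : K)) '' t)) =
      Ideal.span ((fun c => monomial c (1 : K)) ''
        ((fun a => Finsupp.sumElim a 0) '' s ∪ (fun b => Finsupp.sumElim 0 b) '' t)) := by
  rw [disjointSum, Ideal.map_span, Ideal.map_span, ← Ideal.span_union]
  congr 1
  simp only [Set.image_union, Set.image_image]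
  congr 1
  · exact Set.image_congr fun a _ => rename_inl_monomial a
  · exact Set.image_congr fun b _ => rename_inr_monomial b

variable {I p : Ideal (MvPolynomial σ K)} {J q : Ideal (MvPolynomial τ K)}

theorem IsMonomialIdeal.disjointSum (hI : IsMonomialIdeal I) (hJ : IsMonomialIdeal J) :
    IsMonomialIdeal (disjointSum I J) := by
  obtain ⟨s, rfl⟩ := hI
  obtain ⟨t, rfl⟩ := hJ
  exact ⟨_, disjointSum_span s t⟩

theorem sumElim_le_sumElim {a c : σ →₀ ℕ} {b d : τ →₀ ℕ} :
    Finsupp.sumElim a b ≤ Finsupp.sumElim c d ↔ a ≤ c ∧ b ≤ d := by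
  simp only [Finsupp.le_def, Sum.forall, Finsupp.sumElim_inl, Finsupp.sumElim_inr]

theorem IsMonomialIdeal.sumElim_mem_expSet (hI : IsMonomialIdeal I) (hJ : IsMonomialIdeal J)
    {a : σ →₀ ℕ} {b : τ →₀ ℕ} :
    Finsupp.sumElim a b ∈ expSet (_root_.disjointSum I J) ↔ a ∈ expSet I ∨ b ∈ expSet J := by
  obtain ⟨s, rfl⟩ := hI
  obtain ⟨t, rfl⟩ := hJ
  rw [disjointSum_span]
  simp only [mem_expSet_span, Set.mem_union, or_and_right, exists_or, Set.exists_mem_image,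
    sumElim_le_sumElim, zero_le, and_true, true_and]

theorem isColonExponent_sumElim_iff {T P : Ideal (MvPolynomial (σ ⊕ τ) K)} {a : σ →₀ ℕ}
    {b : τ →₀ ℕ} : IsColonExponent T P (Finsupp.sumElim a b) ↔
      ∀ c e, Finsupp.sumElim (a + c) (b + e) ∈ expSet T ↔ Finsupp.sumElim c e ∈ expSet P := by
  simp only [Finsupp.sumElim_add]
  refine ⟨fun h c e => h _, fun h d => ?_⟩
  obtain ⟨c, e, rfl⟩ := exists_sumElim_eq d
  exact h c e

theorem disjointSum_isPrime [Finite σ] [Finite τ] (hp : IsMonomialIdeal p)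
    (hq : IsMonomialIdeal q) (hpp : p.IsPrime) (hqp : q.IsPrime) : (disjointSum p q).IsPrime := by
  refine (hp.disjointSum hq).isPrime_of_expSet ?_ fun a b hab => ?_
  · rw [← Finsupp.sumElim_zero_zero, hp.sumElim_mem_expSet hq]
    exact not_or.2 ⟨hpp.zero_notMem_expSet, hqp.zero_notMem_expSet⟩
  · obtain ⟨a, a', rfl⟩ := exists_sumElim_eq a
    obtain ⟨b, b', rfl⟩ := exists_sumElim_eq b
    rw [← Finsupp.sumElim_add] at hab
    rw [hp.sumElim_mem_expSet hq, hpp.add_mem_expSet_iff, hqp.add_mem_expSet_iff] at hab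
    rw [hp.sumElim_mem_expSet hq, hp.sumElim_mem_expSet hq]
    tauto

/-- A monomial prime of the big polynomial ring is the sum of its two contractions. -/
theorem IsMonomialIdeal.exists_eq_disjointSum {P : Ideal (MvPolynomial (σ ⊕ τ) K)}
    (hP : IsMonomialIdeal P) (hPp : P.IsPrime) :
    ∃ (p : Ideal (MvPolynomial σ K)) (q : Ideal (MvPolynomial τ K)), IsMonomialIdeal p ∧
      p.IsPrime ∧ IsMonomialIdeal q ∧ q.IsPrime ∧ P = _root_.disjointSum p q := by
  let f : MvPolynomial σ K →ₐ[K] MvPolynomial (σ ⊕ τ) K := rename Sum.inl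
  let g : MvPolynomial τ K →ₐ[K] MvPolynomial (σ ⊕ τ) K := rename Sum.inr
  have hf : ∀ a, a ∈ expSet (P.comap f) ↔ Finsupp.sumElim a 0 ∈ expSet P := by
    intro a
    rw [mem_expSet, Ideal.mem_comap, mem_expSet, ← rename_inl_monomial]
  have hg : ∀ b, b ∈ expSet (P.comap g) ↔ Finsupp.sumElim 0 b ∈ expSet P := by
    intro b
    rw [mem_expSet, Ideal.mem_comap, mem_expSet, ← rename_inr_monomial]
  have hp : IsMonomialIdeal (P.comap f) := by
    refine isMonomialIdeal_of_forall_mem fun x hx a ha => ?_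
    rw [hf]
    refine hP.mem_expSet_of_mem (Ideal.mem_comap.1 hx) ?_
    rw [mem_support_iff, Finsupp.sumElim_eq_add, Finsupp.mapDomain_zero, add_zero,
      coeff_rename_mapDomain _ Sum.inl_injective]
    exact mem_support_iff.1 ha
  have hq : IsMonomialIdeal (P.comap g) := by
    refine isMonomialIdeal_of_forall_mem fun x hx a ha => ?_
    rw [hg]
    refine hP.mem_expSet_of_mem (Ideal.mem_comap.1 hx) ?_
    rw [mem_support_iff, Finsupp.sumElim_eq_add, Finsupp.mapDomain_zero, zero_add,
      coeff_rename_mapDomain _ Sum.inr_injective]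
    exact mem_support_iff.1 ha
  refine ⟨P.comap f, P.comap g, hp, hPp.comap _, hq, hPp.comap _,
    hP.eq_of_expSet_eq (hp.disjointSum hq) ?_⟩
  ext c
  obtain ⟨a, b, rfl⟩ := exists_sumElim_eq c
  rw [hp.sumElim_mem_expSet hq, hf, hg, ← hPp.add_mem_expSet_iff, ← Finsupp.sumElim_add,
    add_zero, zero_add]

theorem disjointSum_le_disjointSum_iff {p' : Ideal (MvPolynomial σ K)}
    {q' : Ideal (MvPolynomial τ K)} (hp : IsMonomialIdeal p) (hq : IsMonomialIdeal q)
    (hp' : IsMonomialIdeal p') (hq' : IsMonomialIdeal q') (hpp' : p'.IsPrime)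
    (hqp' : q'.IsPrime) : disjointSum p q ≤ disjointSum p' q' ↔ p ≤ p' ∧ q ≤ q' := by
  constructor
  · intro h
    constructor
    · refine hp.le_of_expSet_subset fun a ha => ?_
      exact ((hp'.sumElim_mem_expSet hq').1 (expSet_mono h ((hp.sumElim_mem_expSet hq).2
        (Or.inl ha)))).resolve_right hqp'.zero_notMem_expSet
    · refine hq.le_of_expSet_subset fun a ha => ?_
      exact ((hp'.sumElim_mem_expSet hq').1 (expSet_mono h ((hp.sumElim_mem_expSet hq).2
        (Or.inr ha)))).resolve_left hpp'.zero_notMem_expSet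
  · rintro ⟨h1, h2⟩
    exact sup_le_sup (Ideal.map_mono h1) (Ideal.map_mono h2)

theorem IsMonomialIdeal.sumElim_mem_expSet_pow (hI : IsMonomialIdeal I) (hJ : IsMonomialIdeal J)
    {k : ℕ} {a : σ →₀ ℕ} {b : τ →₀ ℕ} :
    Finsupp.sumElim a b ∈ expSet (_root_.disjointSum I J ^ k) ↔
      ∃ i j, i + j = k ∧ a ∈ expSet (I ^ i) ∧ b ∈ expSet (J ^ j) := by
  induction k generalizing a b with
  | zero => simp [mem_expSet]
  | succ k ih =>
    constructor
    · intro h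
      rw [pow_succ] at h
      obtain ⟨x, hx, y, hy, hxy⟩ :=
        ((hI.disjointSum hJ).pow k).exists_add_of_mem_expSet_mul (hI.disjointSum hJ) h
      obtain ⟨a₁, b₁, rfl⟩ := exists_sumElim_eq x
      obtain ⟨a₂, b₂, rfl⟩ := exists_sumElim_eq y
      obtain ⟨i, j, hij, ha, hb⟩ := ih.1 hx
      rw [← Finsupp.sumElim_add] at hxy
      obtain ⟨rfl, rfl⟩ : a₁ + a₂ = a ∧ b₁ + b₂ = b :=
        ⟨le_antisymm (sumElim_le_sumElim.1 hxy.le).1 (sumElim_le_sumElim.1 hxy.ge).1,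
          le_antisymm (sumElim_le_sumElim.1 hxy.le).2 (sumElim_le_sumElim.1 hxy.ge).2⟩
      rcases (hI.sumElim_mem_expSet hJ).1 hy with hy | hy
      · exact ⟨i + 1, j, by omega, pow_succ I i ▸ add_mem_expSet_mul ha hy,
          add_mem_expSet_right _ hb⟩
      · exact ⟨i, j + 1, by omega, add_mem_expSet_right _ ha,
          pow_succ J j ▸ add_mem_expSet_mul hb hy⟩
    · rintro ⟨i, j, hij, ha, hb⟩
      rw [pow_succ]
      cases i with
      | succ i =>
        rw [pow_succ] at ha
        obtain ⟨a₁, ha₁, a₂, ha₂, rfl⟩ := (hI.pow i).exists_add_of_mem_expSet_mul hI ha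
        rw [← add_zero b, Finsupp.sumElim_add]
        exact add_mem_expSet_mul (ih.2 ⟨i, j, by omega, ha₁, hb⟩)
          ((hI.sumElim_mem_expSet hJ).2 (Or.inl ha₂))
      | zero =>
        obtain rfl : j = k + 1 := by omega
        rw [pow_succ] at hb
        obtain ⟨b₁, hb₁, b₂, hb₂, rfl⟩ := (hJ.pow k).exists_add_of_mem_expSet_mul hJ hb
        rw [← add_zero a, Finsupp.sumElim_add]
        exact add_mem_expSet_mul (ih.2 ⟨0, k, by omega, ha, hb₁⟩)
          ((hI.sumElim_mem_expSet hJ).2 (Or.inr hb₂))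

variable [Finite σ] [Finite τ]

/-- A colon exponent `(a, b)` of the sum has `x^a ∉ I` and `y^b ∉ J`, so testing it on monomials in
one block of variables isolates one summand. -/
theorem disjointSum_mem_idealAss_iff (hI : IsMonomialIdeal I) (hJ : IsMonomialIdeal J)
    (hp : IsMonomialIdeal p) (hq : IsMonomialIdeal q) (hpp : p.IsPrime) (hqp : q.IsPrime) :
    disjointSum p q ∈ idealAss (disjointSum I J) ↔ p ∈ idealAss I ∧ q ∈ idealAss J := by
  rw [(hI.disjointSum hJ).mem_idealAss_iff, hI.mem_idealAss_iff, hJ.mem_idealAss_iff]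
  constructor
  · rintro ⟨-, -, x, hx⟩
    obtain ⟨a, b, rfl⟩ := exists_sumElim_eq x
    simp only [isColonExponent_sumElim_iff, hI.sumElim_mem_expSet hJ,
      hp.sumElim_mem_expSet hq] at hx
    have h0 : a ∉ expSet I ∧ b ∉ expSet J := by
      have := hx 0 0
      rw [add_zero, add_zero] at this
      exact not_or.1 fun h => (this.1 h).elim hpp.zero_notMem_expSet hqp.zero_notMem_expSet
    refine ⟨⟨hp, hpp, a, fun c => ?_⟩, hq, hqp, b, fun e => ?_⟩
    · simpa [h0.2, hqp.zero_notMem_expSet] using hx c 0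
    · simpa [h0.1, hpp.zero_notMem_expSet] using hx 0 e
  · rintro ⟨⟨-, -, a, ha⟩, -, -, b, hb⟩
    refine ⟨hp.disjointSum hq, disjointSum_isPrime hp hq hpp hqp, Finsupp.sumElim a b, ?_⟩
    simp only [isColonExponent_sumElim_iff, hI.sumElim_mem_expSet hJ, hp.sumElim_mem_expSet hq]
    exact fun c e => or_congr (ha c) (hb e)

theorem IsMonomialIdeal.of_mem_minimalPrimes (hI : IsMonomialIdeal I) (hp : p ∈ I.minimalPrimes) :
    IsMonomialIdeal p :=
  (hI.of_mem_primes (t := .minimal) hp).1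

theorem disjointSum_mem_minimalPrimes_iff (hI : IsMonomialIdeal I) (hJ : IsMonomialIdeal J)
    (hp : IsMonomialIdeal p) (hq : IsMonomialIdeal q) (hpp : p.IsPrime) (hqp : q.IsPrime) :
    disjointSum p q ∈ (disjointSum I J).minimalPrimes ↔
      p ∈ I.minimalPrimes ∧ q ∈ J.minimalPrimes := by
  constructor
  · rintro ⟨⟨-, hle⟩, hmin⟩
    obtain ⟨hIp, hJq⟩ := (disjointSum_le_disjointSum_iff hI hJ hp hq hpp hqp).1 hle
    obtain ⟨p', hp', hp'p⟩ := Ideal.exists_minimalPrimes_le hIp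
    obtain ⟨q', hq', hq'q⟩ := Ideal.exists_minimalPrimes_le hJq
    have hp'm := hI.of_mem_minimalPrimes hp'
    have hq'm := hJ.of_mem_minimalPrimes hq'
    have := hmin ⟨disjointSum_isPrime hp'm hq'm hp'.1.1 hq'.1.1,
      sup_le_sup (Ideal.map_mono hp'.1.2) (Ideal.map_mono hq'.1.2)⟩
      (sup_le_sup (Ideal.map_mono hp'p) (Ideal.map_mono hq'q))
    obtain ⟨h1, h2⟩ := (disjointSum_le_disjointSum_iff hp hq hp'm hq'm hp'.1.1 hq'.1.1).1 this
    exact ⟨le_antisymm h1 hp'p ▸ hp', le_antisymm h2 hq'q ▸ hq'⟩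
  · rintro ⟨hpI, hqJ⟩
    have := disjointSum_isPrime hp hq hpp hqp
    have hle : disjointSum I J ≤ disjointSum p q :=
      sup_le_sup (Ideal.map_mono hpI.1.2) (Ideal.map_mono hqJ.1.2)
    obtain ⟨P, hP, hPle⟩ := Ideal.exists_minimalPrimes_le hle
    obtain ⟨p', q', hp', hpp', hq', hqp', rfl⟩ :=
      ((hI.disjointSum hJ).of_mem_minimalPrimes hP).exists_eq_disjointSum hP.1.1
    obtain ⟨h1, h2⟩ := (disjointSum_le_disjointSum_iff hp' hq' hp hq hpp hqp).1 hPle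
    obtain ⟨h3, h4⟩ := (disjointSum_le_disjointSum_iff hI hJ hp' hq' hpp' hqp').1 hP.1.2
    rwa [← le_antisymm h1 (hpI.2 ⟨hpp', h3⟩ h1), ← le_antisymm h2 (hqJ.2 ⟨hqp', h4⟩ h2)]

theorem disjointSum_mem_primes_iff {t : SymbolicPowerKind} (hI : IsMonomialIdeal I)
    (hJ : IsMonomialIdeal J) (hp : IsMonomialIdeal p) (hq : IsMonomialIdeal q) (hpp : p.IsPrime)
    (hqp : q.IsPrime) :
    disjointSum p q ∈ t.primes (disjointSum I J) ↔ p ∈ t.primes I ∧ q ∈ t.primes J :=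
  match t with
  | .associated => disjointSum_mem_idealAss_iff hI hJ hp hq hpp hqp
  | .minimal => disjointSum_mem_minimalPrimes_iff hI hJ hp hq hpp hqp

/-- The binomial expansion of the symbolic powers of `I + J`. -/
theorem IsMonomialIdeal.sumElim_mem_expSet_symbolicPower (hI : IsMonomialIdeal I)
    (hJ : IsMonomialIdeal J) {t : SymbolicPowerKind} {k : ℕ} {a : σ →₀ ℕ} {b : τ →₀ ℕ} :
    Finsupp.sumElim a b ∈ expSet (_root_.symbolicPower t (_root_.disjointSum I J) k) ↔
      ∃ i j, i + j = k ∧ a ∈ expSet (_root_.symbolicPower t I i) ∧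
        b ∈ expSet (_root_.symbolicPower t J j) := by
  classical
  have hIJ := hI.disjointSum hJ
  constructor
  · intro h
    by_contra! H
    have h0 : a ∈ expSet (_root_.symbolicPower t I 0) := by
      rw [symbolicPower_zero]
      trivial
    -- With `u` maximal, `x^a ∉ I^(u+1)` fails at some `p` and `y^b ∉ J^(k-u)` at some `q`. These
    -- are chosen independently, yet `p + q` is a prime attached to `I + J`, and localizing there
    -- gives the contradiction.
    let u := Nat.findGreatest (fun i => a ∈ expSet (_root_.symbolicPower t I i)) k
    have hu : a ∈ expSet (_root_.symbolicPower t I u) :=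
      Nat.findGreatest_spec (P := fun i => a ∈ expSet (_root_.symbolicPower t I i))
        (Nat.zero_le k) h0
    have huk : u ≤ k := Nat.findGreatest_le k
    have hb := H u (k - u) (by omega) hu
    have huk' : u < k := by
      refine lt_of_le_of_ne huk fun he => hb ?_
      rw [he, Nat.sub_self, symbolicPower_zero]
      trivial
    have ha : a ∉ expSet (_root_.symbolicPower t I (u + 1)) :=
      Nat.findGreatest_is_greatest (Nat.lt_succ_self u) huk'
    rw [hI.mem_expSet_symbolicPower] at ha
    rw [hJ.mem_expSet_symbolicPower] at hb
    push Not at ha hb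
    obtain ⟨p, hp, hpa⟩ := ha
    obtain ⟨q, hq, hqb⟩ := hb
    obtain ⟨hpm, hpp⟩ := hI.of_mem_primes hp
    obtain ⟨hqm, hqp⟩ := hJ.of_mem_primes hq
    obtain ⟨x, hx, hxab⟩ := hIJ.mem_expSet_symbolicPower.1 h _
      ((disjointSum_mem_primes_iff hI hJ hpm hqm hpp hqp).2 ⟨hp, hq⟩)
    obtain ⟨c, e, rfl⟩ := exists_sumElim_eq x
    rw [hpm.sumElim_mem_expSet hqm, not_or] at hx
    rw [← Finsupp.sumElim_add, hI.sumElim_mem_expSet_pow hJ] at hxab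
    obtain ⟨i, j, hij, hi, hj⟩ := hxab
    rcases le_or_gt i u with hiu | hiu
    · exact hqb e hx.2 (expSet_mono (Ideal.pow_le_pow_right (by omega)) hj)
    · exact hpa c hx.1 (expSet_mono (Ideal.pow_le_pow_right hiu) hi)
  · rintro ⟨i, j, hij, ha, hb⟩
    rw [hIJ.mem_expSet_symbolicPower]
    intro P hP
    obtain ⟨hPm, hPp⟩ := hIJ.of_mem_primes hP
    obtain ⟨p, q, hp, hpp, hq, hqp, rfl⟩ := hPm.exists_eq_disjointSum hPp
    obtain ⟨hpI, hqJ⟩ := (disjointSum_mem_primes_iff hI hJ hp hq hpp hqp).1 hP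
    obtain ⟨c, hc, hca⟩ := hI.mem_expSet_symbolicPower.1 ha p hpI
    obtain ⟨e, he, heb⟩ := hJ.mem_expSet_symbolicPower.1 hb q hqJ
    refine ⟨Finsupp.sumElim c e, ?_, ?_⟩
    · rw [hp.sumElim_mem_expSet hq]
      exact not_or.2 ⟨hc, he⟩
    · rw [← Finsupp.sumElim_add, hI.sumElim_mem_expSet_pow hJ]
      exact ⟨i, j, hij, hca, heb⟩

end Sums

/-! ### Colon exponents for a convolution of two filtrations. -/

section Filtrations

open MvPolynomial

variable {σ τ K : Type*} [Field K] {F : ℕ → Ideal (MvPolynomial σ K)}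
  {G : ℕ → Ideal (MvPolynomial τ K)} {T : Ideal (MvPolynomial (σ ⊕ τ) K)} {k : ℕ}
  {p : Ideal (MvPolynomial σ K)} {q : Ideal (MvPolynomial τ K)} {a : σ →₀ ℕ} {b : τ →₀ ℕ}

/-- If `i + j = k` then `i ≥ k - d` or `j ≥ d + 1`, which puts the colon inside `p + q`. The last
two hypotheses supply the complementary factors for the reverse inclusion. -/
theorem isColonExponent_sumElim_of_filtration (hF : Antitone F) (hG : Antitone G)
    (hT : ∀ a b, Finsupp.sumElim a b ∈ expSet T ↔
      ∃ i j, i + j = k ∧ a ∈ expSet (F i) ∧ b ∈ expSet (G j))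
    (hp : IsMonomialIdeal p) (hq : IsMonomialIdeal q) {d : ℕ} (hd : d < k)
    (ha : IsColonExponent (F (k - d)) p a) (hb : IsColonExponent (G (d + 1)) q b)
    (haF : a ∈ expSet (F (k - d - 1))) (hbG : b ∈ expSet (G d)) :
    IsColonExponent T (disjointSum p q) (Finsupp.sumElim a b) := by
  refine isColonExponent_sumElim_iff.2 fun c e => ?_
  rw [hT, hp.sumElim_mem_expSet hq]
  constructor
  · rintro ⟨i, j, hij, hi, hj⟩
    rcases le_or_gt (k - d) i with h | h
    · exact Or.inl ((ha c).1 (expSet_mono (hF h) hi))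
    · exact Or.inr ((hb e).1 (expSet_mono (hG (show d + 1 ≤ j by omega)) hj))
  · rintro (h | h)
    · exact ⟨k - d, d, by omega, (ha c).2 h, add_mem_expSet_right e hbG⟩
    · exact ⟨k - d - 1, d + 1, by omega, add_mem_expSet_right c haF, (hb e).2 h⟩

/-- Given `F 0 = ⊤` and `p` proper, there is a largest index `u ≤ k` for which `x ^ (a + c) ∈ F u`
for some `x ^ c ∉ p`. -/
theorem exists_greatest_index (hF0 : F 0 = ⊤) (hpp : p.IsPrime) (a : σ →₀ ℕ) (k : ℕ) :
    ∃ u, (∃ c ∉ expSet p, a + c ∈ expSet (F u)) ∧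
      ∀ c ∉ expSet p, ∀ i ≤ k, a + c ∈ expSet (F i) → i ≤ u := by
  classical
  refine ⟨Nat.findGreatest (fun i => ∃ c ∉ expSet p, a + c ∈ expSet (F i)) k,
    Nat.findGreatest_spec (P := fun i => ∃ c ∉ expSet p, a + c ∈ expSet (F i)) (Nat.zero_le k)
      ⟨0, hpp.zero_notMem_expSet, ?_⟩, fun c hc i hi h => Nat.le_findGreatest hi ⟨c, hc, h⟩⟩
  rw [hF0]
  trivial

/-- Let `u`, `d` be the largest indices reached from `x^a`, `y^b` by monomials outside `p`, `q`.
Then `u + d < k`, as the two multipliers have product outside `p + q`. Multiplying by a monomial of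
`p` and by the `q`-side multiplier lands in `T` with `j ≤ d`, forcing `i ≥ k - d`; symmetrically `i
≤ u` forces `j ≥ d + 1`. -/
theorem IsColonExponent.exists_of_filtration (hF : Antitone F) (hG : Antitone G)
    (hF0 : F 0 = ⊤) (hG0 : G 0 = ⊤)
    (hT : ∀ a b, Finsupp.sumElim a b ∈ expSet T ↔
      ∃ i j, i + j = k ∧ a ∈ expSet (F i) ∧ b ∈ expSet (G j))
    (hp : IsMonomialIdeal p) (hq : IsMonomialIdeal q) (hpp : p.IsPrime) (hqp : q.IsPrime)
    (h : IsColonExponent T (disjointSum p q) (Finsupp.sumElim a b)) :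
    ∃ d < k, IsColonExponent (F (k - d)) p a ∧ IsColonExponent (G (d + 1)) q b := by
  have h' : ∀ c e, (∃ i j, i + j = k ∧ a + c ∈ expSet (F i) ∧ b + e ∈ expSet (G j)) ↔
      c ∈ expSet p ∨ e ∈ expSet q := by
    intro c e
    rw [← hT, isColonExponent_sumElim_iff.1 h, hp.sumElim_mem_expSet hq]
  obtain ⟨u, ⟨c₀, hc₀, hu⟩, hu'⟩ := exists_greatest_index hF0 hpp a k
  obtain ⟨d, ⟨e₀, he₀, hd⟩, hd'⟩ := exists_greatest_index hG0 hqp b k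
  have hud : u + d < k := by
    by_contra hk
    -- No bound `d ≤ k` is available yet; `min d k` and the truncated `k - d` still add up to `k`.
    refine ((h' c₀ e₀).1 ⟨k - d, min d k, by omega, ?_, ?_⟩).elim hc₀ he₀
    · exact expSet_mono (hF (by omega)) hu
    · exact expSet_mono (hG (by omega)) hd
  refine ⟨d, by omega, fun c => ⟨fun hc => ?_, fun hc => ?_⟩, fun e => ⟨fun he => ?_, fun he => ?_⟩⟩
  · by_contra hcp
    have := hu' c hcp (k - d) (by omega) hc
    omega
  · obtain ⟨i, j, hij, hi, hj⟩ := (h' c e₀).2 (Or.inl hc)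
    have := hd' e₀ he₀ j (by omega) hj
    exact expSet_mono (hF (by omega)) hi
  · by_contra heq
    have := hd' e heq (d + 1) (by omega) he
    omega
  · obtain ⟨i, j, hij, hi, hj⟩ := (h' c₀ e).2 (Or.inr he)
    have := hu' c₀ hc₀ i (by omega) hi
    exact expSet_mono (hG (by omega)) hj

end Filtrations

/-! ### The v-numbers of symbolic powers of a sum. -/

section LocalVNumber

open MvPolynomial

variable {σ τ K : Type*} [Field K] {I p : Ideal (MvPolynomial σ K)}
  {J q : Ideal (MvPolynomial τ K)}

theorem degree_sumElim (a : σ →₀ ℕ) (b : τ →₀ ℕ) :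
    (Finsupp.sumElim a b).degree = a.degree + b.degree := by
  rw [Finsupp.sumElim_eq_add, map_add, Finsupp.degree_mapDomain, Finsupp.degree_mapDomain]

theorem localVNumber_symbolicPower_disjointSum_isLeast [Finite σ] [Finite τ]
    (hI : IsMonomialIdeal I) (hJ : IsMonomialIdeal J) (hI0 : I ≠ ⊥) (hJ0 : J ≠ ⊥)
    (t : SymbolicPowerKind) (k : ℕ)
    (hp : IsMonomialIdeal p) (hpp : p.IsPrime) (hq : IsMonomialIdeal q) (hqp : q.IsPrime)
    (hpq : disjointSum p q ∈ idealAss (symbolicPower t (disjointSum I J) k)) :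
    IsLeast
      {v : ℕ | ∃ d < k, p ∈ idealAss (symbolicPower t I (k - d)) ∧
        q ∈ idealAss (symbolicPower t J (d + 1)) ∧
        v = localVNumber (symbolicPower t I (k - d)) p +
          localVNumber (symbolicPower t J (d + 1)) q}
      (localVNumber (symbolicPower t (disjointSum I J) k) (disjointSum p q)) := by
  have hIk := fun i => hI.symbolicPower t i
  have hJk := fun i => hJ.symbolicPower t i
  have hTk := (hI.disjointSum hJ).symbolicPower t k
  have hT : ∀ a b, Finsupp.sumElim a b ∈ expSet (symbolicPower t (disjointSum I J) k) ↔
      ∃ i j, i + j = k ∧ a ∈ expSet (symbolicPower t I i) ∧ b ∈ expSet (symbolicPower t J j) :=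
    fun a b => hI.sumElim_mem_expSet_symbolicPower hJ
  have hv := hTk.localVNumber_isLeast hpq
  have hlower : ∀ d < k, p ∈ idealAss (symbolicPower t I (k - d)) →
      q ∈ idealAss (symbolicPower t J (d + 1)) →
      localVNumber (symbolicPower t (disjointSum I J) k) (disjointSum p q) ≤
        localVNumber (symbolicPower t I (k - d)) p +
          localVNumber (symbolicPower t J (d + 1)) q := by
    intro d hd hpd hqd
    obtain ⟨a, ha, hav⟩ := ((hIk _).localVNumber_isLeast hpd).1
    obtain ⟨b, hb, hbv⟩ := ((hJk _).localVNumber_isLeast hqd).1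
    rw [← hav, ← hbv, ← degree_sumElim]
    refine hv.2 ⟨_, isColonExponent_sumElim_of_filtration symbolicPower_antitone
      symbolicPower_antitone hT hp hq hd ha hb ?_ ?_, rfl⟩
    -- The side conditions `x^a ∈ I^(k-d-1)` and `y^b ∈ J^(d)` come from deleting a variable; `d <
    -- k` makes `k - d` a successor.
    · refine hI.mem_expSet_symbolicPower_of_isColonExponent hI0 hpp ?_
      rwa [Nat.sub_add_cancel (by omega)]
    · exact hJ.mem_expSet_symbolicPower_of_isColonExponent hJ0 hqp hb
  refine ⟨?_, ?_⟩
  · obtain ⟨x, hx, hxv⟩ := hv.1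
    obtain ⟨a, b, rfl⟩ := exists_sumElim_eq x
    obtain ⟨d, hd, ha, hb⟩ := hx.exists_of_filtration symbolicPower_antitone
      symbolicPower_antitone symbolicPower_zero symbolicPower_zero hT hp hq hpp hqp
    have hpd := (hIk _).mem_idealAss_iff.2 ⟨hp, hpp, a, ha⟩
    have hqd := (hJk _).mem_idealAss_iff.2 ⟨hq, hqp, b, hb⟩
    refine ⟨d, hd, hpd, hqd, le_antisymm (hlower d hd hpd hqd) ?_⟩
    rw [← hxv, degree_sumElim]
    exact add_le_add (((hIk _).localVNumber_isLeast hpd).2 ⟨a, ha, rfl⟩)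
      (((hJk _).localVNumber_isLeast hqd).2 ⟨b, hb, rfl⟩)
  · rintro _ ⟨d, hd, hpd, hqd, rfl⟩
    exact hlower d hd hpd hqd

end LocalVNumber

/-- `t` is either of the two conventions for symbolic powers. `IsLeast` says that the minimum
exists and is attained at the given number. -/
theorem corollary2p5 {K : Type*} [Field K] (n m : ℕ) (t : SymbolicPowerKind)
    (I : Ideal (MvPolynomial (Fin n) K)) (J : Ideal (MvPolynomial (Fin m) K))
    (hI : IsMonomialIdeal I) (hJ : IsMonomialIdeal J) (hI0 : I ≠ ⊥) (hJ0 : J ≠ ⊥) (k : ℕ) :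
    (∀ (p : Ideal (MvPolynomial (Fin n) K)) (q : Ideal (MvPolynomial (Fin m) K)),
      IsMonomialIdeal p → p.IsPrime → IsMonomialIdeal q → q.IsPrime →
      disjointSum p q ∈ idealAss (symbolicPower t (disjointSum I J) k) →
      IsLeast
        {v : ℕ | ∃ d < k, p ∈ idealAss (symbolicPower t I (k - d)) ∧
          q ∈ idealAss (symbolicPower t J (d + 1)) ∧
          v = localVNumber (symbolicPower t I (k - d)) p +
            localVNumber (symbolicPower t J (d + 1)) q}
        (localVNumber (symbolicPower t (disjointSum I J) k) (disjointSum p q))) ∧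
    (symbolicPower t (disjointSum I J) k ≠ ⊤ →
      IsLeast
        {v : ℕ | ∃ d < k, ∃ p ∈ idealAss (symbolicPower t I (k - d)),
          ∃ q ∈ idealAss (symbolicPower t J (d + 1)),
          disjointSum p q ∈ idealAss (symbolicPower t (disjointSum I J) k) ∧
          v = localVNumber (symbolicPower t I (k - d)) p +
            localVNumber (symbolicPower t J (d + 1)) q}
        (vNumber (symbolicPower t (disjointSum I J) k))) := by
  have hTk := (hI.disjointSum hJ).symbolicPower t k
  refine ⟨fun p q hp hpp hq hqp hpq => localVNumber_symbolicPower_disjointSum_isLeast hI hJ hI0 hJ0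
    t k hp hpp hq hqp hpq, fun hne => ⟨?_, ?_⟩⟩
  -- An associated prime attaining the v-number is monomial, hence some `p + q`, so the local
  -- formula applies to it.
  · obtain ⟨P, hP, hPv⟩ := (hTk.vNumber_isLeast hne).1
    obtain ⟨hPm, hPp, -⟩ := hTk.mem_idealAss_iff.1 hP
    obtain ⟨p, q, hp, hpp, hq, hqp, rfl⟩ := hPm.exists_eq_disjointSum hPp
    obtain ⟨d, hd, hpd, hqd, hv⟩ := (localVNumber_symbolicPower_disjointSum_isLeast hI hJ hI0 hJ0
      t k hp hpp hq hqp hP).1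
    exact ⟨d, hd, p, hpd, q, hqd, hP, hPv.symm.trans hv⟩
  · rintro _ ⟨d, hd, p, hpd, q, hqd, hP, rfl⟩
    obtain ⟨hp, hpp, -⟩ := (hI.symbolicPower t _).mem_idealAss_iff.1 hpd
    obtain ⟨hq, hqp, -⟩ := (hJ.symbolicPower t _).mem_idealAss_iff.1 hqd
    exact ((hTk.vNumber_isLeast hne).2 ⟨_, hP, rfl⟩).trans
      ((localVNumber_symbolicPower_disjointSum_isLeast hI hJ hI0 hJ0 t k hp hpp hq hqp hP).2
        ⟨d, hd, hpd, hqd, rfl⟩)
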